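/- Let $G$ be a finite group. A virtual character of $G$ is an integral linear combination of irreducible complex characters of $G$. An $S$-character of $G$ is a virtual character $\psi$ of $G$ such that (1) $\psi$ contains the trivial character $1_G$ exactly once, i.e. $\frac{1}{|G|}\sum_{g\in G}\psi(g)=1$, and (2) all values $\psi(g)$, $g\in G$, are non-negative real numbers. It is called ordinary if it is an actual character, i.e. the character of a finite-dimensional complex representation of $G$. **Proposition.** Let $G$ be a finite solvable group and let $\psi\neq 1_G$ be an ordinary $S$-character of $G$. Then there is an element $g\in G$ whose order is a prime power $p^k$ with $p$ prime and $k\ge 1$, such that $\psi(g)=0$. -/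

import Mathlib

namespace SChar

/-- `χ` is an (actual) complex character of `G`: the trace function of a finite-dimensional
complex representation of `G`. (Each such representation is isomorphic to one on a space in
`Type`, for instance some `Fin n → ℂ`, so the universe is no restriction.) -/
def IsCharacter {G : Type*} [Group G] (χ : G → ℂ) : Prop :=
  ∃ (V : Type) (_ : AddCommGroup V) (_ : Module ℂ V) (_ : FiniteDimensional ℂ V)
    (ρ : Representation ℂ G V), χ = ρ.character

/-- `χ` is an irreducible complex character of `G`: the trace function of an irreducible
finite-dimensional complex representation of `G`. -/
def IsIrreducibleCharacter {G : Type*} [Group G] (χ : G → ℂ) : Prop :=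
  ∃ (V : Type) (_ : AddCommGroup V) (_ : Module ℂ V) (_ : FiniteDimensional ℂ V)
    (ρ : Representation ℂ G V), ρ.IsIrreducible ∧ χ = ρ.character

/-- A virtual character: an integral linear combination of irreducible complex characters. -/
def IsVirtualCharacter {G : Type*} [Group G] (ψ : G → ℂ) : Prop :=
  ψ ∈ Submodule.span ℤ {χ : G → ℂ | IsIrreducibleCharacter χ}

/-- The usual scalar product `[φ, ψ] = |G|⁻¹ ∑ g, φ(g) * conj ψ(g)` of functions on a finite
group. For a virtual character `φ` and an irreducible character `ψ` it is the multiplicity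
of `ψ` in `φ`. -/
noncomputable def scalarProduct {G : Type*} [Group G] [Fintype G] (φ ψ : G → ℂ) : ℂ :=
  (Fintype.card G : ℂ)⁻¹ * ∑ g : G, φ g * (starRingEnd ℂ) (ψ g)

/-- An `S`-character of a finite group: a virtual character that contains the trivial
character (the constant function `1`) exactly once and all of whose values are non-negative
real numbers. -/
structure IsSCharacter {G : Type*} [Group G] [Fintype G] (ψ : G → ℂ) : Prop where
  isVirtualCharacter : IsVirtualCharacter ψ
  trivial_once : scalarProduct ψ (1 : G → ℂ) = 1
  nonneg : ∀ g : G, (ψ g).im = 0 ∧ 0 ≤ (ψ g).re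

/-- An `S`-character is ordinary if it is an actual character. -/
def IsOrdinarySCharacter {G : Type*} [Group G] [Fintype G] (ψ : G → ℂ) : Prop :=
  IsSCharacter ψ ∧ IsCharacter ψ

end SChar

open Polynomial Module

namespace SChar

/-! Induction on `|G|`, with a nontrivial normal subgroup `N` of prime exponent. Averaging over the
cosets of `N` gives the character of `G ⧸ N` on the invariants `V^N`, again non-negative with mean
`1`. If `dim V^N ≠ 1`, it vanishes at an element of prime power order, which lifts to such an
element of `G`; a vanishing average of non-negative values has only zero terms. If `dim V^N = 1`,
the restriction to `N` has mean `1`. Without zeros, the product of its values would be a nonzero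
rational integer, so by AM-GM all values would be `1`, against the degree
(`character_eq_one_of_forall_ne_zero`). So it has a zero in `N`, at an element of order `p`. -/

/-- The traces of the powers of an endomorphism of finite order `n` are the values of an integral
polynomial at the powers of a primitive `n`-th root of unity. -/
theorem exists_polynomial_trace_pow {V : Type*} [AddCommGroup V] [Module ℂ V]
    [FiniteDimensional ℂ V] {n : ℕ} (hn : n ≠ 0) {ζ : ℂ} (hζ : IsPrimitiveRoot ζ n)
    (T : End ℂ V) (hT : T ^ n = 1) :
    ∃ f : ℤ[X], ∀ k : ℕ, LinearMap.trace ℂ V (T ^ k) = aeval (ζ ^ k) f := by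
  have hss : T.IsSemisimple := by
    apply End.isSemisimple_of_squarefree_aeval_eq_zero (p := X ^ n - C 1)
    · exact (separable_X_pow_sub_C 1 (by exact_mod_cast hn) one_ne_zero).squarefree
    · simp [hT]
  have hint : DirectSum.IsInternal T.eigenspace :=
    (DirectSum.isInternal_submodule_iff_iSupIndep_and_iSup_eq_top _).2
      ⟨T.eigenspaces_iSupIndep, hss.iSup_eigenspace_eq_top⟩
  have hfin : {μ | T.eigenspace μ ≠ ⊥}.Finite :=
    WellFoundedGT.finite_ne_bot_of_iSupIndep T.eigenspaces_iSupIndep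
  have hpow (k : ℕ) (μ : ℂ) (v : V) (hv : v ∈ T.eigenspace μ) : (T ^ k) v = μ ^ k • v := by
    rw [End.mem_eigenspace_iff] at hv
    induction k with
    | zero => simp
    | succ k ih => rw [pow_succ, End.mul_apply, hv, map_smul, ih, smul_smul, pow_succ, mul_comm]
  have hroot (μ : ℂ) (hμ : T.eigenspace μ ≠ ⊥) : ∃ j : ℕ, ζ ^ j = μ := by
    obtain ⟨v, hv, hv0⟩ := Submodule.exists_mem_ne_zero_of_ne_bot hμ
    have h := hpow n μ v hv
    rw [hT, End.one_apply] at h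
    have h1 : μ ^ n = 1 := by
      have : (μ ^ n - 1) • v = 0 := by rw [sub_smul, one_smul, ← h, sub_self]
      exact sub_eq_zero.1 ((smul_eq_zero.1 this).resolve_right hv0)
    have : NeZero n := ⟨hn⟩
    obtain ⟨j, -, hj⟩ := hζ.eq_pow_of_pow_eq_one h1
    exact ⟨j, hj⟩
  choose! j hj using hroot
  -- `T` is diagonalizable with eigenvalues `μ = ζ ^ j μ`, so `μ ^ k = (ζ ^ k) ^ j μ`: one
  -- polynomial serves all `k`.
  refine ⟨∑ μ ∈ hfin.toFinset, C (finrank ℂ (T.eigenspace μ) : ℤ) * X ^ j μ, fun k ↦ ?_⟩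
  have hmaps (μ : ℂ) : Set.MapsTo (T ^ k) (T.eigenspace μ) (T.eigenspace μ) := fun v hv ↦ by
    rw [hpow k μ v hv]
    exact Submodule.smul_mem _ _ hv
  rw [LinearMap.trace_eq_sum_trace_restrict' hint hfin hmaps, map_sum]
  refine Finset.sum_congr rfl fun μ hμ ↦ ?_
  have hμ' : T.eigenspace μ ≠ ⊥ := by simpa using hμ
  have : (T ^ k).restrict (hmaps μ) = μ ^ k • LinearMap.id := by
    ext v
    exact hpow k μ v v.2
  rw [this, map_smul, LinearMap.trace_id]
  simp only [map_mul, aeval_C, map_pow, aeval_X, smul_eq_mul]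
  rw [← pow_mul, mul_comm k, pow_mul, hj μ hμ']
  simp [mul_comm]

/-- A value of an integral polynomial that is the same at all primitive `n`-th roots of unity has
absolute value at least `1`, unless it vanishes. -/
theorem one_le_norm_aeval_of_forall_coprime {n : ℕ} (hn : n ≠ 0) {ζ : ℂ}
    (hζ : IsPrimitiveRoot ζ n) (P : ℤ[X])
    (hP : ∀ k : ℕ, k.Coprime n → aeval (ζ ^ k) P = aeval ζ P) (h0 : aeval ζ P ≠ 0) :
    1 ≤ ‖aeval ζ P‖ := by
  have : NeZero n := ⟨hn⟩
  let K := IntermediateField.adjoin ℚ {ζ}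
  have : FiniteDimensional ℚ K :=
    IntermediateField.adjoin.finiteDimensional (hζ.isIntegral (Nat.pos_of_ne_zero hn)).tower_top
  let z : K := IntermediateField.AdjoinSimple.gen ℚ ζ
  have hK : IsPrimitiveRoot z n := IsPrimitiveRoot.of_map_of_injective (f := K.val)
    (by simpa [z] using hζ) K.val.injective
  have hint : IsIntegral ℤ (aeval z P) := by
    have hz : IsIntegral ℤ z := hK.isIntegral (Nat.pos_of_ne_zero hn)
    rw [aeval_eq_sum_range]
    exact IsIntegral.sum _ fun i _ ↦ (hz.pow i).smul _
  -- Each embedding sends `z` to some `ζ ^ k` with `k` coprime to `n`, so all conjugates of the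
  -- value coincide.
  have hnorm : algebraMap ℚ ℂ (Algebra.norm ℚ (aeval z P)) =
      aeval ζ P ^ Fintype.card (K →ₐ[ℚ] ℂ) := by
    rw [Algebra.norm_eq_prod_embeddings, Finset.prod_congr rfl (g := fun _ ↦ aeval ζ P)]
    · simp
    · intro τ _
      have hτ : IsPrimitiveRoot (τ z) n := hK.map_of_injective τ.injective
      obtain ⟨k, -, hk, hk'⟩ := (hζ.isPrimitiveRoot_iff).1 hτ
      have : τ (aeval z P) = aeval (τ z) P := by
        exact (aeval_algHom_apply (τ.restrictScalars ℤ) z P).symm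
      rw [this, ← hk', hP k hk]
  obtain ⟨m, hm⟩ := IsIntegrallyClosed.isIntegral_iff.1 (Algebra.isIntegral_norm ℚ hint)
  rw [← hm] at hnorm
  have hm0 : m ≠ 0 := by
    rintro rfl
    exact pow_ne_zero _ h0 (by simpa using hnorm.symm)
  have h1 : 1 ≤ ‖aeval ζ P‖ ^ Fintype.card (K →ₐ[ℚ] ℂ) := by
    rw [← norm_pow, ← hnorm]
    simpa using (by exact_mod_cast Int.one_le_abs hm0 : (1 : ℝ) ≤ |(m : ℝ)|)
  have : Nonempty (K →ₐ[ℚ] ℂ) := ⟨K.val⟩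
  by_contra! hlt
  exact absurd h1 (not_le.2 (pow_lt_one₀ (norm_nonneg _) hlt Fintype.card_ne_zero))

/-- The product of the values of a character without zeros has absolute value at least `1`. -/
theorem one_le_norm_prod_character {G V : Type*} [Group G] [Fintype G] [AddCommGroup V]
    [Module ℂ V] [FiniteDimensional ℂ V] (ρ : Representation ℂ G V)
    (h0 : ∀ g, ρ.character g ≠ 0) : 1 ≤ ‖∏ g, ρ.character g‖ := by
  have hn : Nat.card G ≠ 0 := Nat.card_pos.ne'
  have hζ := Complex.isPrimitiveRoot_exp _ hn
  set ζ := Complex.exp (2 * Real.pi * Complex.I / (Nat.card G : ℕ))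
  have h (g : G) := exists_polynomial_trace_pow hn hζ (ρ g)
    (by rw [← map_pow, pow_card_eq_one', map_one])
  choose f hf using h
  have hP (k : ℕ) : aeval (ζ ^ k) (∏ g, f g) = ∏ g, ρ.character (g ^ k) := by
    rw [map_prod]
    exact Finset.prod_congr rfl fun g _ ↦ by rw [← hf, Representation.character, map_pow ρ]
  have hP1 : aeval ζ (∏ g, f g) = ∏ g, ρ.character g := by simpa using hP 1
  rw [← hP1]
  refine one_le_norm_aeval_of_forall_coprime hn hζ _ (fun k hk ↦ ?_) ?_
  · rw [hP, hP1]
    exact Fintype.prod_equiv (powCoprime hk.symm) _ _ fun g ↦ rfl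
  · rw [hP1]
    exact Finset.prod_ne_zero_iff.2 fun g _ ↦ h0 g

/-- Positive reals with mean at most `1` and product at least `1` are all equal to `1`. -/
theorem eq_one_of_sum_le_card_of_one_le_prod {ι : Type*} [Fintype ι] (x : ι → ℝ)
    (hpos : ∀ i, 0 < x i) (hsum : ∑ i, x i ≤ Fintype.card ι) (hprod : 1 ≤ ∏ i, x i) (i : ι) :
    x i = 1 := by
  by_contra hne
  have hlog : 0 ≤ ∑ i, Real.log (x i) := by
    rw [← Real.log_prod fun i _ ↦ (hpos i).ne']
    exact Real.log_nonneg hprod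
  have hlt : ∑ i, Real.log (x i) < ∑ i, (x i - 1) :=
    Finset.sum_lt_sum (fun j _ ↦ Real.log_le_sub_one_of_pos (hpos j))
      ⟨i, Finset.mem_univ i, Real.log_lt_sub_one_of_pos (hpos i) hne⟩
  simp only [Finset.sum_sub_distrib, Finset.sum_const, Finset.card_univ, nsmul_eq_mul,
    mul_one] at hlt
  linarith

/-- A character with non-negative values and mean `1` that has no zeros is trivial. -/
theorem character_eq_one_of_forall_ne_zero {G V : Type*} [Group G] [Fintype G] [AddCommGroup V]
    [Module ℂ V] [FiniteDimensional ℂ V] (ρ : Representation ℂ G V)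
    (hnonneg : ∀ g, (ρ.character g).im = 0 ∧ 0 ≤ (ρ.character g).re)
    (hsum : ∑ g, ρ.character g = Fintype.card G) (h0 : ∀ g, ρ.character g ≠ 0) (g : G) :
    ρ.character g = 1 := by
  have hre (g : G) : ρ.character g = ((ρ.character g).re : ℂ) :=
    Complex.ext rfl (by simp [(hnonneg g).1])
  have hnorm (g : G) : ‖ρ.character g‖ = (ρ.character g).re := by
    rw [hre g, Complex.norm_real, Real.norm_of_nonneg (hnonneg g).2, Complex.ofReal_re]
  rw [hre g, eq_one_of_sum_le_card_of_one_le_prod (fun g ↦ (ρ.character g).re)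
    (fun g ↦ (hnorm g).symm ▸ norm_pos_iff.2 (h0 g)) ?_ ?_ g, Complex.ofReal_one]
  · rw [← Complex.re_sum, hsum, Complex.natCast_re]
  · simpa only [norm_prod, hnorm] using one_le_norm_prod_character ρ h0

/-- The character of `G ⧸ N` on the `N`-invariants is the mean over the cosets of `N`. -/
theorem character_quotientToInvariants {G V : Type*} [Group G] [AddCommGroup V]
    [Module ℂ V] [FiniteDimensional ℂ V] (ρ : Representation ℂ G V) (N : Subgroup G) [N.Normal]
    [Fintype N] (g : G) :
    (ρ.quotientToInvariants N).character (g : G ⧸ N) =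
      (Fintype.card N : ℂ)⁻¹ * ∑ n : N, ρ.character (g * n) := by
  have : Invertible (Fintype.card N : ℂ) := invertibleOfNonzero (by simp)
  let σ : Representation ℂ N V := ρ.comp N.subtype
  have hproj := σ.isProj_averageMap
  -- By cyclicity of the trace, the trace on the invariants becomes that of `ρ g` times the
  -- averaging projection on `V`.
  have hr : hproj.codRestrict ∘ₗ (ρ g ∘ₗ σ.invariants.subtype) =
      ρ.quotientToInvariants N (g : G ⧸ N) := by
    ext v
    exact σ.averageMap_id _ (ρ.le_comap_invariants N g v.2)
  rw [Representation.character, ← hr, LinearMap.trace_comp_comm', LinearMap.comp_assoc,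
    hproj.subtype_comp_codRestrict]
  have : σ.averageMap = (Fintype.card N : ℂ)⁻¹ • ∑ n : N, ρ n := by
    simp [Representation.averageMap, GroupAlgebra.average, σ]
  rw [this, LinearMap.comp_smul, map_smul, smul_eq_mul, ← End.mul_eq_comp, Finset.mul_sum, map_sum]
  simp [Representation.character]

/-- A nontrivial finite solvable group has a nontrivial normal subgroup of prime exponent. -/
theorem exists_normal_forall_pow_prime_eq_one (G : Type*) [Group G] [Finite G]
    [Group.IsSolvable G] [Nontrivial G] :
    ∃ (p : ℕ) (N : Subgroup G), p.Prime ∧ N.Normal ∧ N ≠ ⊥ ∧ ∀ g ∈ N, g ^ p = 1 := by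
  classical
  have hex : ∃ n, derivedSeries G n = ⊥ := Group.IsSolvable.solvable
  obtain ⟨k, hk⟩ : ∃ k, Nat.find hex = k + 1 := Nat.exists_eq_succ_of_ne_zero fun h ↦ by
    simpa [h] using Nat.find_spec hex
  have hA : derivedSeries G k ≠ ⊥ := Nat.find_min hex (by omega)
  have hA' : derivedSeries G (k + 1) = ⊥ := hk ▸ Nat.find_spec hex
  set A := derivedSeries G k with hAdef
  have hAn : A.Normal := derivedSeries_normal G k
  have hcomm (a b : G) (ha : a ∈ A) (hb : b ∈ A) : Commute a b := by
    have := Subgroup.commutator_mem_commutator ha hb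
    rw [← derivedSeries_succ, hA', Subgroup.mem_bot] at this
    exact commutatorElement_eq_one_iff_commute.1 this
  have hcard : Nat.card A ≠ 1 := fun h ↦ hA (Subgroup.card_eq_one.1 h)
  have hp := Nat.minFac_prime hcard
  set p := (Nat.card A).minFac
  have : Fact p.Prime := ⟨hp⟩
  obtain ⟨a, ha⟩ := exists_prime_orderOf_dvd_card' p (Nat.minFac_dvd (Nat.card A))
  -- The `p`-torsion of the last nontrivial, hence abelian, derived subgroup.
  refine ⟨p, { carrier := {g | g ∈ A ∧ g ^ p = 1}
               one_mem' := ⟨A.one_mem, one_pow p⟩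
               mul_mem' := fun {x y} hx hy ↦ ⟨A.mul_mem hx.1 hy.1, by
                 rw [(hcomm x y hx.1 hy.1).mul_pow, hx.2, hy.2, one_mul]⟩
               inv_mem' := fun {x} hx ↦ ⟨A.inv_mem hx.1, by rw [inv_pow, hx.2, inv_one]⟩ },
    hp, ⟨fun n hn g ↦ ⟨hAn.conj_mem n hn.1 g, by rw [conj_pow, hn.2, mul_one, mul_inv_cancel]⟩⟩,
    fun h ↦ ?_, fun g hg ↦ hg.2⟩
  have ha1 : (a : G) = 1 := by
    rw [← Subgroup.mem_bot, ← h]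
    exact ⟨a.2, by exact_mod_cast ha ▸ pow_orderOf_eq_one a⟩
  rw [OneMemClass.coe_eq_one.1 ha1, orderOf_one] at ha
  exact hp.one_lt.ne ha

/-- An element of prime power order of a quotient lifts to an element of prime power order. -/
theorem exists_mk_eq_isPrimePow_orderOf {G : Type*} [Group G] [Finite G] (N : Subgroup G)
    [N.Normal] (x : G ⧸ N) (hx : IsPrimePow (orderOf x)) :
    ∃ g : G, (g : G ⧸ N) = x ∧ IsPrimePow (orderOf g) := by
  obtain ⟨p, k, hp, hk, hpk⟩ := hx
  rw [← Nat.prime_iff] at hp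
  obtain ⟨h, rfl⟩ := QuotientGroup.mk_surjective x
  obtain ⟨e, m, hm, hem⟩ := Nat.exists_eq_pow_mul_and_not_dvd (orderOf_pos h).ne' p hp.ne_one
  have hmx : ((h : G ⧸ N)) ^ (p ^ k) = 1 := hpk ▸ pow_orderOf_eq_one _
  have hcop : m.Coprime (p ^ k) := ((hp.coprime_iff_not_dvd.2 hm).symm).pow_right k
  obtain ⟨c, -, hc⟩ := Nat.exists_mul_mod_eq_one_of_coprime hcop
    (one_lt_pow₀ hp.one_lt hk.ne')
  have hmk : ((h ^ (m * c) : G) : G ⧸ N) = h := by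
    rw [QuotientGroup.mk_pow, ← pow_mod_orderOf, ← hpk, hc, pow_one]
  -- The factor `m` removes the prime-to-`p` part of `h`; `m * c ≡ 1` mod `p ^ k` preserves the
  -- image.
  refine ⟨h ^ (m * c), hmk, ?_⟩
  have hdvd : orderOf (h ^ (m * c)) ∣ p ^ e := orderOf_dvd_of_pow_eq_one (by
    rw [← pow_mul, show m * c * p ^ e = orderOf h * c by rw [hem]; ring, pow_mul,
      pow_orderOf_eq_one, one_pow])
  obtain ⟨l, -, hl⟩ := (Nat.dvd_prime_pow hp).1 hdvd
  rw [hl]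
  refine hp.isPrimePow.pow fun h0 ↦ ?_
  rw [h0, pow_zero, orderOf_eq_one_iff] at hl
  rw [hl, QuotientGroup.mk_one] at hmk
  rw [← hmk, orderOf_one] at hpk
  exact (one_lt_pow₀ hp.one_lt hk.ne').ne' hpk

open ComplexOrder in
/-- A character of a finite solvable group with non-negative values and mean `1`, whose degree is
not `1`, vanishes at some element of prime power order. -/
theorem exists_character_eq_zero {G : Type*} [Group G] [Fintype G] [Group.IsSolvable G]
    {V : Type*} [AddCommGroup V] [Module ℂ V] [FiniteDimensional ℂ V]
    (ρ : Representation ℂ G V) (hnonneg : ∀ g, 0 ≤ ρ.character g)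
    (hsum : ∑ g, ρ.character g = Fintype.card G) (hdim : finrank ℂ V ≠ 1) :
    ∃ g : G, IsPrimePow (orderOf g) ∧ ρ.character g = 0 := by
  induction hc : Nat.card G using Nat.strong_induction_on generalizing G V with
  | _ n ih =>
  classical
  rcases subsingleton_or_nontrivial G with hG | hG
  · refine absurd ?_ hdim
    have : Fintype.card G = 1 := Fintype.card_eq_one_iff.2 ⟨1, fun g ↦ Subsingleton.elim _ _⟩
    rw [Fintype.sum_subsingleton _ 1, Representation.char_one, this] at hsum
    exact_mod_cast hsum
  obtain ⟨p, N, hp, hN, hN1, hpow⟩ := exists_normal_forall_pow_prime_eq_one G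
  have hcN : (Fintype.card N : ℂ) ≠ 0 := by simp
  have hchar := character_quotientToInvariants ρ N
  set τ := ρ.quotientToInvariants N
  by_cases hd : finrank ℂ (Representation.invariants (ρ.comp N.subtype)) = 1
  · let σ : Representation ℂ N V := ρ.comp N.subtype
    have hσ : ∑ n, σ.character n = Fintype.card N := by
      have h := hchar 1
      rw [QuotientGroup.mk_one, Representation.char_one, hd, Nat.cast_one, eq_comm,
        inv_mul_eq_one₀ hcN] at h
      simpa [σ, Representation.character] using h.symm
    have h0 : ∃ n, σ.character n = 0 := by
      by_contra! h
      have := character_eq_one_of_forall_ne_zero σ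
        (fun n ↦ ⟨(Complex.nonneg_iff.1 (hnonneg n)).2.symm, (Complex.nonneg_iff.1 (hnonneg n)).1⟩)
        hσ h 1
      rw [Representation.char_one] at this
      exact hdim (by exact_mod_cast this)
    obtain ⟨n, hn⟩ := h0
    refine ⟨n, ?_, hn⟩
    -- A zero at `1` would force `V = 0`, contradicting `dim V^N = 1`.
    have hne : (n : G) ≠ 1 := by
      intro h1
      rw [OneMemClass.coe_eq_one.1 h1, Representation.char_one, Nat.cast_eq_zero] at hn
      have := finrank_zero_iff.1 hn
      have := finrank_zero_of_subsingleton (R := ℂ)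
        (M := Representation.invariants (ρ.comp N.subtype))
      omega
    have : Fact p.Prime := ⟨hp⟩
    rw [orderOf_eq_prime (hpow n n.2) hne]
    exact hp.isPrimePow
  · have hnn (x : G ⧸ N) : 0 ≤ τ.character x := by
      obtain ⟨g, rfl⟩ := QuotientGroup.mk_surjective x
      rw [hchar]
      exact mul_nonneg (by positivity) (Finset.sum_nonneg fun n _ ↦ hnonneg _)
    have hs : ∑ x, τ.character x = Fintype.card (G ⧸ N) := by
      have h1 : ∑ g : G, τ.character g = Fintype.card N * ∑ x, τ.character x := by
        have : ∑ g : G, τ.character g = ∑ y : (G ⧸ N) × N, τ.character y.1 :=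
          Fintype.sum_equiv N.groupEquivQuotientProdSubgroup _ _ fun g ↦ rfl
        rw [this, Fintype.sum_prod_type]
        simp [Finset.mul_sum]
      have h2 : ∑ g : G, τ.character g = Fintype.card G := by
        simp only [hchar, ← Finset.mul_sum]
        have (n : N) : ∑ g, ρ.character (g * n) = Fintype.card G :=
          (Equiv.sum_comp (Equiv.mulRight (n : G)) ρ.character).trans hsum
        rw [Finset.sum_comm]
        simp [this]
      have h3 : (Fintype.card G : ℂ) = Fintype.card (G ⧸ N) * Fintype.card N := by
        simp only [← Nat.card_eq_fintype_card]
        exact_mod_cast N.card_eq_card_quotient_mul_card_subgroup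
      exact mul_left_cancel₀ hcN (by rw [← h1, h2, h3, mul_comm])
    have hlt : Nat.card (G ⧸ N) < n := by
      rw [← hc, N.card_eq_card_quotient_mul_card_subgroup]
      exact lt_mul_of_one_lt_right Nat.card_pos (N.one_lt_card_iff_ne_bot.2 hN1)
    obtain ⟨x, hx, hx0⟩ := ih _ hlt τ hnn hs hd rfl
    obtain ⟨g, rfl, hg⟩ := exists_mk_eq_isPrimePow_orderOf N x hx
    refine ⟨g, hg, ?_⟩
    rw [hchar, mul_eq_zero, or_iff_right (inv_ne_zero hcN),
      Finset.sum_eq_zero_iff_of_nonneg fun n _ ↦ hnonneg _] at hx0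
    simpa using hx0 1 (Finset.mem_univ _)

/-- A character of degree `1` has no zeros. -/
theorem character_ne_zero_of_finrank_eq_one {G V : Type*} [Group G] [AddCommGroup V]
    [Module ℂ V] (ρ : Representation ℂ G V) (hV : finrank ℂ V = 1) (g : G) :
    ρ.character g ≠ 0 := by
  intro h0
  have hfd : FiniteDimensional ℂ V := FiniteDimensional.of_finrank_eq_succ hV
  obtain ⟨v, hv, hspan⟩ := finrank_eq_one_iff'.1 hV
  obtain ⟨c, hc⟩ := hspan (ρ g v)
  have hρ : ρ g = c • LinearMap.id := by
    ext w
    obtain ⟨d, rfl⟩ := hspan w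
    simp [← hc]
  rw [Representation.character, hρ, map_smul, LinearMap.trace_id, hV] at h0
  have hc0 : c = 0 := by simpa using h0
  apply hv
  rw [← ρ.inv_self_apply g v, ← hc, hc0, zero_smul, map_zero]

end SChar

theorem proposition3p2 {G : Type*} [Group G] [Fintype G] [Group.IsSolvable G] (ψ : G → ℂ)
    (hψ : SChar.IsOrdinarySCharacter ψ) (hne : ψ ≠ 1) :
    ∃ g : G, IsPrimePow (orderOf g) ∧ ψ g = 0 := by
  obtain ⟨⟨-, honce, hnonneg⟩, V, _, _, _, ρ, rfl⟩ := hψ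
  have hsum : ∑ g, ρ.character g = Fintype.card G := by
    have h : (Fintype.card G : ℂ)⁻¹ * ∑ g, ρ.character g = 1 := by
      simpa [SChar.scalarProduct] using honce
    exact ((inv_mul_eq_one₀ (by simp)).1 h).symm
  refine SChar.exists_character_eq_zero ρ
    (fun g ↦ Complex.nonneg_iff.2 ⟨(hnonneg g).2, (hnonneg g).1.symm⟩) hsum fun hV ↦ hne ?_
  ext g
  exact SChar.character_eq_one_of_forall_ne_zero ρ hnonneg hsum
    (SChar.character_ne_zero_of_finrank_eq_one ρ hV) g
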